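/- Let $X$ be a real Banach space with dual $X^{*}$ and bidual $X^{**}$. Let $f_0$ and $f_k$ ($k\in T$) be proper convex functions $X\to\mathbb{R}\cup\{+\infty\}$, where either $T=\{1,2,\dots\}$ or $T=\{1,\dots,m\}$ for some $m\ge 0$. No lower semicontinuity is assumed. For $g:X\to[-\infty,+\infty]$ put $\operatorname{dom} g=\{g<+\infty\}$, $g^{*}(x^{*})=\sup_{x\in X}\big(\langle x^{*},x\rangle-g(x)\big)$ for $x^{*}\in X^{*}$, and $g^{**}(z)=\sup_{x^{*}\in X^{*}}\big(\langle z,x^{*}\rangle-g^{*}(x^{*})\big)$ for $z\in X^{**}$. Let $$v(\mathcal P)=\inf\{f_0(x):\ x\in X,\ f_k(x)\le 0\ \text{ for all } k\in T\}\in[-\infty,+\infty].$$ Let $f=\sup_{k\in T}f_k$. Let $f_\infty=\limsup_{k\to\infty}f_k$ (pointwise) if $T$ is infinite, and $f_\infty\equiv-\infty$ if $T$ is finite. The strengthened biconjugate relaxation $(\mathcal P_\infty^{**})$ has optimal value $$v(\mathcal P_\infty^{**})=\inf\Big\{f_0^{**}(z):\ z\in X^{**},\ f_k^{**}(z)\le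 0\ \text{ for all } k\in T,\ f_\infty^{**}(z)\le 0,\ z\in\overline{\operatorname{dom}(f^{**})}^{\,w^{**}}\Big\},$$ where $\overline{A}^{\,w^{**}}$ is the closure of $A\subset X^{**}$ in the weak-* topology $\sigma(X^{**},X^{*})$. Infima over the empty set are $+\infty$ and suprema over it are $-\infty$. Assume the Slater condition: there is $x_0\in\operatorname{dom} f_0$ with $\sup_{k\in T}f_k(x_0)<0$. Assume also that $f$ is continuous at some point of $\operatorname{dom} f_0\cap\operatorname{dom} f$. Then $$v(\mathcal P_\infty^{**})=v(\mathcal P).$$ -/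

import Mathlib

namespace CvxRelax

open Filter

section Functions

variable {E : Type*} [NormedAddCommGroup E] [NormedSpace ℝ E]

/-- The effective domain `{x | g x < +∞}` of an extended-real-valued function. -/
def effDom {S : Type*} (g : S → EReal) : Set S := {x | g x < ⊤}

/-- The epigraph, a subset of `E × ℝ`. -/
def epi (g : E → EReal) : Set (E × ℝ) := {p | g p.1 ≤ (p.2 : EReal)}

/-- `g` is proper: not identically `+∞`, and nowhere `-∞`. -/
def IsProper (g : E → EReal) : Prop := (∃ x, g x ≠ ⊤) ∧ ∀ x, g x ≠ ⊥

/-- `g` is convex: its epigraph is convex. -/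
def IsConvexFn (g : E → EReal) : Prop := Convex ℝ (epi g)

/-- The Fenchel conjugate `g*(y) = sup_x (⟨y, x⟩ - g x)` on the dual space. -/
noncomputable def conj (g : E → EReal) (y : StrongDual ℝ E) : EReal :=
  ⨆ x : E, ((y x : ℝ) : EReal) - g x

/-- The biconjugate `g**`, the conjugate of the conjugate, on the bidual space. -/
noncomputable def biconj (g : E → EReal) : StrongDual ℝ (StrongDual ℝ E) → EReal :=
  conj (conj g)

/-- The closure of a subset of the bidual for the weak-* topology `σ(E**, E*)`. -/
def weakStarClosure (A : Set (StrongDual ℝ (StrongDual ℝ E))) :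
    Set (StrongDual ℝ (StrongDual ℝ E)) :=
  {z | StrongDual.toWeakDual z ∈
    closure (StrongDual.toWeakDual '' A : Set (WeakDual ℝ (StrongDual ℝ E)))}

end Functions

section Program

variable {X : Type*} [NormedAddCommGroup X] [NormedSpace ℝ X]

/-- The indices `k ≥ 1` of the constraints when there are `N` of them: all `k ≥ 1` if `N = ⊤`,
and `1, …, m` if `N = m` is finite. -/
def constraintIdx (N : ℕ∞) : Set ℕ := {k | 1 ≤ k ∧ (k : ℕ∞) ≤ N}

/-- The supremum `f = sup_k f_k` of the constraint functions. -/
noncomputable def supFn (N : ℕ∞) (f : ℕ → X → EReal) (x : X) : EReal :=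
  ⨆ k ∈ constraintIdx N, f k x

open Classical in
/-- `f_∞ = limsup_k f_k` if there are infinitely many constraints; by convention `f_∞ = -∞`
if there are only finitely many. -/
noncomputable def limsupFn (N : ℕ∞) (f : ℕ → X → EReal) (x : X) : EReal :=
  if N = ⊤ then limsup (fun k : ℕ => f k x) atTop else ⊥

/-- The feasible set of the program: `f_k(x) ≤ 0` for every constraint. -/
def feasible (N : ℕ∞) (f : ℕ → X → EReal) : Set X :=
  {x | ∀ k ∈ constraintIdx N, f k x ≤ 0}

/-- The optimal value of `inf f_0(x)` subject to `f_k(x) ≤ 0`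
(`+∞` when the program is infeasible). -/
noncomputable def value (N : ℕ∞) (f : ℕ → X → EReal) : EReal :=
  ⨅ x ∈ feasible N f, f 0 x

/-- The Slater condition: some `x₀ ∈ dom f_0` satisfies `sup_k f_k(x₀) < 0`. -/
def Slater (N : ℕ∞) (f : ℕ → X → EReal) : Prop :=
  ∃ x₀ ∈ effDom (f 0), supFn N f x₀ < 0

/-- The feasible set of the strengthened relaxation: `f_k**(z) ≤ 0` for every constraint,
`f_∞**(z) ≤ 0`, and `z` lies in the weak-* closure of `dom f**`. -/
def relaxedFeasible (N : ℕ∞) (f : ℕ → X → EReal) : Set (StrongDual ℝ (StrongDual ℝ X)) :=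
  {z | (∀ k ∈ constraintIdx N, biconj (f k) z ≤ 0) ∧
    biconj (limsupFn N f) z ≤ 0 ∧
    z ∈ weakStarClosure (effDom (biconj (supFn N f)))}

/-- The optimal value of the strengthened relaxation, `inf f_0**(z)` over its feasible set. -/
noncomputable def relaxedValue (N : ℕ∞) (f : ℕ → X → EReal) : EReal :=
  ⨅ z ∈ relaxedFeasible N f, biconj (f 0) z

end Program

end CvxRelax

/-! The canonical embedding of `X` in its bidual gives one inequality. For the other, let `α` be
below the value of the program. Separation yields affine minorants of `l * (f₀ - α)` and `m * sup
f_k` whose sum is zero; Slater forces `l > 0`. It then suffices that the minorant of `m * sup f_k`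
is nonpositive at each relaxed feasible `z` (`TailMinorant.eval_le_zero`).

This is shown by peeling off one constraint at a time: `exists_affine_split` splits a minorant of a
multiple of the tail supremum between the first constraint and the remaining tail. Each peeled piece
is nonpositive at `z`: by `f_k** z ≤ 0` if its multiplier is positive, and by the weak-* closure
condition if it is zero. Boundedness of `sup f_k` above on a ball makes the remainders converge in
norm, so evaluation at `z` passes to the limit; the limit minorizes a multiple of the upper limit,
and `f_∞** z ≤ 0` finishes. -/

namespace CvxRelax

open Filter Topology

/-! ### Splitting affine minorants of a maximum -/

section Split

variable {E : Type*} [NormedAddCommGroup E] [NormedSpace ℝ E]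

/-- The map `((x, t), (x', t')) ↦ (x' - x, t - y x, t' - y x)`. -/
def gapMap (y : StrongDual ℝ E) : (E × ℝ) × (E × ℝ) →ₗ[ℝ] E × ℝ × ℝ where
  toFun p := (p.2.1 - p.1.1, p.1.2 - y p.1.1, p.2.2 - y p.1.1)
  map_add' p q := by
    ext
    · simp; abel
    · simp; ring
    · simp; ring
  map_smul' a p := by
    ext
    · simp [smul_sub]
    · simp; ring
    · simp; ring

/-- The image of `P ×ˢ Q` under `gapMap` misses `(0, c - e, c - e)` for every `e > 0`, and the ball
gives it interior points. A functional separating its interior from `(0, c, c)` supplies the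
multipliers and the linear parts. -/
theorem exists_affine_split_one {P Q : Set (E × ℝ)} (hP : Convex ℝ P) (hQ : Convex ℝ Q)
    (hPup : ∀ x t t', (x, t) ∈ P → t ≤ t' → (x, t') ∈ P)
    (hQup : ∀ x t t', (x, t) ∈ Q → t ≤ t' → (x, t') ∈ Q)
    {x₁ : E} {a r M : ℝ} (ha : (x₁, a) ∈ P) (hr : 0 < r)
    (hQb : ∀ x ∈ Metric.ball x₁ r, (x, M) ∈ Q) (y : StrongDual ℝ E) (c : ℝ)
    (h : ∀ x t, (x, t) ∈ P → (x, t) ∈ Q → y x + c ≤ t) :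
    ∃ (l m : ℝ) (y₁ y₂ : StrongDual ℝ E) (c₁ c₂ : ℝ), 0 ≤ l ∧ 0 ≤ m ∧ l + m = 1 ∧
      y₁ + y₂ = y ∧ c₁ + c₂ = c ∧ (∀ x t, (x, t) ∈ P → y₁ x + c₁ ≤ l * t) ∧
      (∀ x t, (x, t) ∈ Q → y₂ x + c₂ ≤ m * t) := by
  set A : Set (E × ℝ × ℝ) := gapMap y '' (P ×ˢ Q) with hA
  have hAc : Convex ℝ A := (hP.prod hQ).linear_image _
  have hmem : ∀ x t x' t', (x, t) ∈ P → (x', t') ∈ Q → (x' - x, t - y x, t' - y x) ∈ A :=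
    fun x t x' t' h1 h2 => ⟨((x, t), (x', t')), ⟨h1, h2⟩, rfl⟩
  set U : Set (E × ℝ × ℝ) := Metric.ball 0 r ×ˢ Set.Ioi (a - y x₁) ×ˢ Set.Ioi (M - y x₁)
    with hU
  have hUo : IsOpen U := Metric.isOpen_ball.prod (isOpen_Ioi.prod isOpen_Ioi)
  have hUA : U ⊆ A := by
    rintro ⟨u, s, s'⟩ ⟨hu, hs, hs'⟩
    simp only [Metric.mem_ball, dist_zero_right, Set.mem_Ioi] at hu hs hs'
    have := hmem x₁ (s + y x₁) (x₁ + u) (s' + y x₁) (hPup _ _ _ ha (by linarith))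
      (hQup _ _ _ (hQb (x₁ + u) (by simpa using hu)) (by linarith))
    simpa using this
  have hUi : U ⊆ interior A := interior_maximal hUA hUo
  have hU0 : ((0 : E), a - y x₁ + 1, M - y x₁ + 1) ∈ U :=
    ⟨by simpa using hr, by simp, by simp⟩
  have hne : (interior A).Nonempty := ⟨_, hUi hU0⟩
  have hnot : ((0 : E), c, c) ∉ interior A := by
    intro hin
    have hcont : Tendsto (fun e : ℝ => ((0 : E), c - e, c - e)) (𝓝[>] 0) (𝓝 (0, c, c)) := by
      have : Continuous (fun e : ℝ => ((0 : E), c - e, c - e)) := by fun_prop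
      simpa using (this.tendsto 0).mono_left nhdsWithin_le_nhds
    have hev := hcont.eventually (isOpen_interior.mem_nhds hin)
    obtain ⟨e, he, he0⟩ := (hev.and self_mem_nhdsWithin).exists
    obtain ⟨⟨⟨x, t⟩, ⟨x', t'⟩⟩, ⟨h1, h2⟩, h3⟩ := interior_subset he
    simp only [gapMap, LinearMap.coe_mk, AddHom.coe_mk, Prod.mk.injEq, sub_eq_zero] at h3
    obtain ⟨rfl, h4, h5⟩ := h3
    have h6 : t = t' := by linarith
    subst h6
    have := h _ _ h1 h2
    have he0' : 0 < e := he0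
    linarith
  obtain ⟨φ, hφ⟩ := geometric_hahn_banach_point_open hAc.interior isOpen_interior hnot
  -- A convex set with nonempty interior lies in the closure of that interior.
  have hφA : ∀ q ∈ A, φ (0, c, c) ≤ φ q := by
    intro q hq
    have hcl : closure (interior A) ⊆ {q | φ (0, c, c) ≤ φ q} :=
      closure_minimal (fun b hb => (hφ b hb).le) (isClosed_le continuous_const φ.continuous)
    apply hcl
    rw [hAc.closure_interior_eq_closure_of_nonempty_interior hne]
    exact subset_closure hq
  set η : StrongDual ℝ E := φ.comp (ContinuousLinearMap.inl ℝ E (ℝ × ℝ)) with hη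
  set l := φ (0, 1, 0) with hl
  set m := φ (0, 0, 1) with hm
  have hdec : ∀ u s s', φ (u, s, s') = η u + l * s + m * s' := by
    intro u s s'
    have : (u, s, s') = (u, (0 : ℝ), (0 : ℝ)) + s • ((0 : E), (1 : ℝ), (0 : ℝ))
        + s' • ((0 : E), (0 : ℝ), (1 : ℝ)) := by simp
    rw [this, map_add, map_add, map_smul, map_smul]
    simp only [hη, hl, hm, ContinuousLinearMap.comp_apply, ContinuousLinearMap.inl_apply,
      smul_eq_mul, mul_comm]
    rfl
  have key : ∀ x t x' t', (x, t) ∈ P → (x', t') ∈ Q →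
      l * c + m * c ≤ η (x' - x) + l * (t - y x) + m * (t' - y x) := by
    intro x t x' t' h1 h2
    have := hφA _ (hmem x t x' t' h1 h2)
    rw [hdec, hdec] at this
    simpa using this
  have hx₁Q : (x₁, M) ∈ Q := hQb _ (Metric.mem_ball_self hr)
  have hnonneg : ∀ p k : ℝ, (∀ s : ℝ, 0 ≤ s → k ≤ p * s) → 0 ≤ p := by
    intro p k hk
    by_contra hp
    push Not at hp
    have h1 := hk ((|k| + 1) / (-p)) (by apply div_nonneg; positivity; linarith)
    have h2 : p * ((|k| + 1) / (-p)) = -(|k| + 1) := by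
      rw [div_neg, mul_neg, mul_div_cancel₀ _ hp.ne]
    have := neg_abs_le k
    linarith
  have hl0 : 0 ≤ l := by
    refine hnonneg l (l * c + m * c - l * (a - y x₁) - m * (M - y x₁)) fun s hs => ?_
    have := key x₁ (a + s) x₁ M (hPup _ _ _ ha (by linarith)) hx₁Q
    simp only [sub_self, map_zero] at this
    linarith
  have hm0 : 0 ≤ m := by
    refine hnonneg m (l * c + m * c - l * (a - y x₁) - m * (M - y x₁)) fun s hs => ?_
    have := key x₁ a x₁ (M + s) ha (hQup _ _ _ hx₁Q (by linarith))
    simp only [sub_self, map_zero] at this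
    linarith
  have hpos : 0 < l + m := by
    by_contra hlm
    have hl' : l = 0 := by linarith
    have hm' : m = 0 := by linarith
    have := hφ _ (hUi hU0)
    rw [hdec, hdec, hl', hm'] at this
    simp at this
  set d := l + m with hd
  have key2 : ∀ x t x' t', (x, t) ∈ P → (x', t') ∈ Q →
      c ≤ d⁻¹ * η (x' - x) + (l / d) * t + (m / d) * t' - y x := by
    intro x t x' t' h1 h2
    have := key x t x' t' h1 h2
    have h3 : d⁻¹ * η (x' - x) + (l / d) * t + (m / d) * t' - y x
        = (η (x' - x) + l * (t - y x) + m * (t' - y x)) / d := by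
      rw [eq_div_iff hpos.ne']
      field_simp
      rw [hd]; ring
    rw [h3, le_div_iff₀ hpos]
    rw [hd]; linarith
  -- The inequality `key2` separates the variables of `P` and `Q`; the infimum of the `Q` side is
  -- the constant of the second minorant.
  set S : Set ℝ := (fun p : E × ℝ => d⁻¹ * η p.1 + (m / d) * p.2) '' Q with hS
  have hSne : S.Nonempty := ⟨_, (x₁, M), hx₁Q, rfl⟩
  have hlow : ∀ x t, (x, t) ∈ P → ∀ s ∈ S, c + d⁻¹ * η x + y x - (l / d) * t ≤ s := by
    rintro x t h1 _ ⟨⟨x', t'⟩, h2, rfl⟩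
    have := key2 x t x' t' h1 h2
    rw [map_sub] at this
    simp only
    linarith
  refine ⟨l / d, m / d, d⁻¹ • η + y, -(d⁻¹ • η), c - sInf S, sInf S, by positivity,
    by positivity, ?_, by abel, by ring, ?_, ?_⟩
  · rw [← add_div, div_self hpos.ne']
  · intro x t h1
    have := le_csInf hSne (hlow x t h1)
    simp only [add_apply, smul_apply, smul_eq_mul]
    linarith
  · intro x t h2
    have : sInf S ≤ d⁻¹ * η x + (m / d) * t := csInf_le ⟨_, hlow x₁ a ha⟩ ⟨(x, t), h2, rfl⟩
    simp only [neg_apply, smul_apply, smul_eq_mul]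
    linarith

theorem convex_domain_prod_Ici {P : Set (E × ℝ)} (hP : Convex ℝ P) :
    Convex ℝ {p : E × ℝ | (∃ t, (p.1, t) ∈ P) ∧ 0 ≤ p.2} := by
  have h := (hP.linear_image (LinearMap.fst ℝ E ℝ)).prod (convex_Ici (𝕜 := ℝ) (0 : ℝ))
  convert h using 1
  ext ⟨x, s⟩
  simp

/-- Splitting of an affine minorant of `ρ * max φ ψ`, where `φ`, `ψ` are the convex functions with
epigraphs `P`, `Q`, and `0 * φ` is read as the indicator function of the domain. -/
theorem exists_affine_split {P Q : Set (E × ℝ)} (hP : Convex ℝ P) (hQ : Convex ℝ Q)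
    (hPup : ∀ x t t', (x, t) ∈ P → t ≤ t' → (x, t') ∈ P)
    (hQup : ∀ x t t', (x, t) ∈ Q → t ≤ t' → (x, t') ∈ Q)
    {x₁ : E} {a r M : ℝ} (ha : (x₁, a) ∈ P) (hr : 0 < r)
    (hQb : ∀ x ∈ Metric.ball x₁ r, (x, M) ∈ Q) {ρ : ℝ} (hρ : 0 ≤ ρ)
    (y : StrongDual ℝ E) (c : ℝ)
    (h : ∀ x t, (x, t) ∈ P → (x, t) ∈ Q → y x + c ≤ ρ * t) :
    ∃ (l m : ℝ) (y₁ y₂ : StrongDual ℝ E) (c₁ c₂ : ℝ), 0 ≤ l ∧ 0 ≤ m ∧ l + m = ρ ∧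
      y₁ + y₂ = y ∧ c₁ + c₂ = c ∧ (∀ x t, (x, t) ∈ P → y₁ x + c₁ ≤ l * t) ∧
      (∀ x t, (x, t) ∈ Q → y₂ x + c₂ ≤ m * t) := by
  rcases hρ.eq_or_lt with rfl | hρ
  -- For `ρ = 0` only the domains matter: split for their indicator functions and evaluate at height
  -- `0`.
  · obtain ⟨l, m, y₁, y₂, c₁, c₂, -, -, -, hy, hc, h1, h2⟩ :=
      exists_affine_split_one (convex_domain_prod_Ici hP) (convex_domain_prod_Ici hQ)
        (fun x t t' h1 h2 => ⟨h1.1, h1.2.trans h2⟩) (fun x t t' h1 h2 => ⟨h1.1, h1.2.trans h2⟩)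
        (x₁ := x₁) (a := 0) (M := 0) ⟨⟨a, ha⟩, le_rfl⟩ hr
        (fun x hx => ⟨⟨M, hQb x hx⟩, le_rfl⟩) y c (by
          rintro x t ⟨⟨t₁, h1⟩, h0⟩ ⟨⟨t₂, h2⟩, -⟩
          have := h x (max t₁ t₂) (hPup _ _ _ h1 (le_max_left _ _))
            (hQup _ _ _ h2 (le_max_right _ _))
          simp only at h0
          linarith)
    refine ⟨0, 0, y₁, y₂, c₁, c₂, le_rfl, le_rfl, by simp, hy, hc, fun x t hx => ?_,
      fun x t hx => ?_⟩
    · simpa using h1 x 0 ⟨⟨t, hx⟩, le_rfl⟩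
    · simpa using h2 x 0 ⟨⟨t, hx⟩, le_rfl⟩
  · obtain ⟨l, m, y₁, y₂, c₁, c₂, hl, hm, hlm, hy, hc, h1, h2⟩ :=
      exists_affine_split_one hP hQ hPup hQup ha hr hQb (ρ⁻¹ • y) (ρ⁻¹ * c) (by
        intro x t h1 h2
        have := h x t h1 h2
        simp only [smul_apply, smul_eq_mul]
        rw [← mul_add, inv_mul_le_iff₀ hρ]
        exact this)
    refine ⟨ρ * l, ρ * m, ρ • y₁, ρ • y₂, ρ * c₁, ρ * c₂, by positivity, by positivity, ?_, ?_,
      ?_, ?_, ?_⟩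
    · rw [← mul_add, hlm, mul_one]
    · rw [← smul_add, hy, smul_smul, mul_inv_cancel₀ hρ.ne', one_smul]
    · rw [← mul_add, hc, mul_inv_cancel_left₀ hρ.ne']
    · intro x t hx
      simp only [smul_apply, smul_eq_mul]
      rw [← mul_add, mul_assoc]
      exact mul_le_mul_of_nonneg_left (h1 x t hx) hρ.le
    · intro x t hx
      simp only [smul_apply, smul_eq_mul]
      rw [← mul_add, mul_assoc]
      exact mul_le_mul_of_nonneg_left (h2 x t hx) hρ.le

end Split

/-! ### Affine minorants and biconjugates -/

section Biconjugate

variable {E : Type*} [NormedAddCommGroup E] [NormedSpace ℝ E]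

theorem conj_le_of_affine_le {g : E → EReal} {y : StrongDual ℝ E} {c : ℝ}
    (h : ∀ x t, (x, t) ∈ epi g → y x + c ≤ t) : conj g y ≤ ((-c : ℝ) : EReal) := by
  refine iSup_le fun x => ?_
  have hx : ∀ t : ℝ, g x ≤ t → y x + c ≤ t := fun t ht => h x t ht
  generalize g x = b at hx
  induction b with
  | bot => exact absurd (hx (y x + c - 1) bot_le) (by linarith)
  | top => simp
  | coe b =>
    have := hx b le_rfl
    rw [← EReal.coe_sub, EReal.coe_le_coe_iff]
    linarith

theorem affine_le_biconj {g : E → EReal} {y : StrongDual ℝ E} {c : ℝ}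
    (h : ∀ x t, (x, t) ∈ epi g → y x + c ≤ t) (z : StrongDual ℝ (StrongDual ℝ E)) :
    ((z y + c : ℝ) : EReal) ≤ biconj g z := by
  refine le_trans ?_ (le_iSup (fun y : StrongDual ℝ E => ((z y : ℝ) : EReal) - conj g y) y)
  calc ((z y + c : ℝ) : EReal) = ((z y : ℝ) : EReal) - ((-c : ℝ) : EReal) := by
        rw [← EReal.coe_sub, sub_neg_eq_add]
    _ ≤ _ := EReal.sub_le_sub le_rfl (conj_le_of_affine_le h)

theorem affine_div_le_biconj {g : E → EReal} {y : StrongDual ℝ E} {c l : ℝ} (hl : 0 < l)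
    (h : ∀ x t, (x, t) ∈ epi g → y x + c ≤ l * t) (z : StrongDual ℝ (StrongDual ℝ E)) :
    (((z y + c) / l : ℝ) : EReal) ≤ biconj g z := by
  have := affine_le_biconj (g := g) (y := l⁻¹ • y) (c := l⁻¹ * c) (by
    intro x t hx
    rw [smul_apply, smul_eq_mul, ← mul_add, inv_mul_le_iff₀ hl]
    exact h x t hx) z
  rw [map_smul, smul_eq_mul, ← mul_add] at this
  rwa [div_eq_inv_mul]

theorem mem_effDom_of_mem_epi {S : Type*} {g : S → EReal} {x : S} {t : ℝ} (h : (x, t) ∈ epi g) :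
    x ∈ effDom g :=
  lt_of_le_of_lt (show g x ≤ t from h) (EReal.coe_lt_top t)

theorem exists_mem_epi {S : Type*} {g : S → EReal} {x : S} (h : x ∈ effDom g) :
    ∃ t : ℝ, (x, t) ∈ epi g := by
  obtain ⟨t, ht, -⟩ := EReal.lt_iff_exists_real_btwn.1 h
  exact ⟨t, ht.le⟩

/-- Adding any nonnegative multiple of `y + c` to the minorant `y₀ + c₀` keeps it a minorant, so
`biconj f` is infinite wherever `y + c` is positive. The remaining half-space is weak-* closed. -/
theorem le_zero_of_mem_weakStarClosure {f : E → EReal} {y₀ y : StrongDual ℝ E} {c₀ c : ℝ}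
    (h₀ : ∀ x t, (x, t) ∈ epi f → y₀ x + c₀ ≤ t) (h : ∀ x ∈ effDom f, y x + c ≤ 0)
    {z : StrongDual ℝ (StrongDual ℝ E)} (hz : z ∈ weakStarClosure (effDom (biconj f))) :
    z y + c ≤ 0 := by
  have hsub : StrongDual.toWeakDual '' effDom (biconj f) ⊆
      {w : WeakDual ℝ (StrongDual ℝ E) | w y + c ≤ 0} := by
    rintro _ ⟨w, hw, rfl⟩
    change w y + c ≤ 0
    by_contra! hpos
    obtain ⟨B, hB⟩ : ∃ B : ℝ, biconj f w ≤ B := by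
      obtain ⟨B, hB, -⟩ := EReal.lt_iff_exists_real_btwn.1 hw
      exact ⟨B, hB.le⟩
    have key : ∀ s : ℝ, 0 ≤ s → w y₀ + c₀ + s * (w y + c) ≤ B := by
      intro s hs
      have := affine_le_biconj (g := f) (y := y₀ + s • y) (c := c₀ + s * c) (by
        intro x t hx
        have h1 := h₀ x t hx
        have h2 := mul_nonpos_of_nonneg_of_nonpos hs (h x (mem_effDom_of_mem_epi hx))
        simp only [add_apply, smul_apply, smul_eq_mul]
        linarith) w
      have := EReal.coe_le_coe_iff.1 (this.trans hB)
      simp only [map_add, map_smul, smul_eq_mul] at this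
      linarith
    have := key ((|B - (w y₀ + c₀)| + 1) / (w y + c)) (by positivity)
    rw [div_mul_cancel₀ _ hpos.ne'] at this
    have := le_abs_self (B - (w y₀ + c₀))
    linarith
  have hclosed : IsClosed {w : WeakDual ℝ (StrongDual ℝ E) | w y + c ≤ 0} :=
    isClosed_le ((WeakDual.eval_continuous y).add continuous_const) continuous_const
  exact closure_minimal hsub hclosed hz

/-- This is where the closure condition on `z` is needed: for `l = 0` the bound on `biconj g z` says
nothing about `y + c`. -/
theorem le_zero_of_biconj_le_zero {f g : E → EReal} {y₀ y : StrongDual ℝ E} {c₀ c l : ℝ}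
    (h₀ : ∀ x t, (x, t) ∈ epi f → y₀ x + c₀ ≤ t) (hdom : effDom f ⊆ effDom g) (hl : 0 ≤ l)
    (h : ∀ x t, (x, t) ∈ epi g → y x + c ≤ l * t)
    {z : StrongDual ℝ (StrongDual ℝ E)} (hz : z ∈ weakStarClosure (effDom (biconj f)))
    (hgz : biconj g z ≤ 0) : z y + c ≤ 0 := by
  rcases hl.eq_or_lt with rfl | hl
  · refine le_zero_of_mem_weakStarClosure h₀ (fun x hx => ?_) hz
    obtain ⟨t, ht⟩ := exists_mem_epi (hdom hx)
    simpa using h x t ht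
  · have := EReal.coe_le_coe_iff.1 ((affine_div_le_biconj hl h z).trans hgz)
    rwa [div_le_iff₀ hl, zero_mul] at this

theorem biconj_le_self (g : E → EReal) (x : E) :
    biconj g (NormedSpace.inclusionInDoubleDual ℝ E x) ≤ g x := by
  refine iSup_le fun y => ?_
  rw [NormedSpace.dual_def]
  have h : ((y x : ℝ) : EReal) - g x ≤ conj g y :=
    le_iSup (fun x : E => ((y x : ℝ) : EReal) - g x) x
  generalize conj g y = b at h
  generalize g x = a at h
  induction a with
  | top => exact le_top
  | bot => simp at h; simp [h]
  | coe a =>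
    induction b with
    | top => simp
    | bot =>
      rw [← EReal.coe_sub] at h
      exact absurd (le_bot_iff.1 h) (EReal.coe_ne_bot _)
    | coe b =>
      rw [← EReal.coe_sub, EReal.coe_le_coe_iff] at h ⊢
      linarith

theorem iInf_le_biconj (g : E → EReal) (z : StrongDual ℝ (StrongDual ℝ E)) :
    ⨅ x, g x ≤ biconj g z := by
  refine EReal.ge_of_forall_gt_iff_ge.1 fun a ha => ?_
  have := affine_le_biconj (g := g) (y := 0) (c := a) (by
    intro x t hx
    have : (a : EReal) ≤ t := (ha.le.trans (iInf_le g x)).trans (show g x ≤ t from hx)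
    simpa using this) z
  simpa using this

end Biconjugate

/-! ### Peeling off constraints one by one -/

section Tail

variable {E : Type*} [NormedAddCommGroup E] [NormedSpace ℝ E]

/-- The tail supremum `sup_{k ≥ n} g_k`. -/
noncomputable def tailSup {S : Type*} (g : ℕ → S → EReal) (n : ℕ) (x : S) : EReal := ⨆ k ≥ n, g k x

theorem mem_epi_tailSup {S : Type*} {g : ℕ → S → EReal} {n : ℕ} {x : S} {t : ℝ} :
    (x, t) ∈ epi (tailSup g n) ↔ ∀ k ≥ n, (x, t) ∈ epi (g k) := by
  simp [epi, tailSup]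

theorem mem_epi_tailSup_of {S : Type*} {g : ℕ → S → EReal} {n : ℕ} {x : S} {t : ℝ}
    (h : (x, t) ∈ epi (g n)) (h' : (x, t) ∈ epi (tailSup g (n + 1))) :
    (x, t) ∈ epi (tailSup g n) := by
  rw [mem_epi_tailSup] at h' ⊢
  intro k hk
  rcases hk.eq_or_lt with rfl | hk
  · exact h
  · exact h' k hk

theorem convex_epi_tailSup {g : ℕ → E → EReal} (hg : ∀ k, IsConvexFn (g k)) (n : ℕ) :
    IsConvexFn (tailSup g n) := by
  have : epi (tailSup g n) = ⋂ k, ⋂ (_ : k ≥ n), epi (g k) := by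
    ext ⟨x, t⟩
    simp [mem_epi_tailSup]
  rw [IsConvexFn, this]
  exact convex_iInter₂ fun k _ => hg k

theorem epi_upward {S : Type*} {g : S → EReal} (x : S) (t t' : ℝ) (h : (x, t) ∈ epi g)
    (htt' : t ≤ t') : (x, t') ∈ epi g :=
  le_trans (show g x ≤ t from h) (EReal.coe_le_coe_iff.2 htt')

/-- An affine minorant `Y + C` of `ρ * sup_{k ≥ n} g_k`. -/
structure TailMinorant (g : ℕ → E → EReal) (n : ℕ) where
  ρ : ℝ
  Y : StrongDual ℝ E
  C : ℝ
  nonneg : 0 ≤ ρ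
  le : ∀ x t, (x, t) ∈ epi (tailSup g n) → Y x + C ≤ ρ * t

theorem TailMinorant.exists_succ {g : ℕ → E → EReal} (hg : ∀ k, IsConvexFn (g k)) {x₁ : E}
    {r M : ℝ} (hr : 0 < r) (hb : ∀ x ∈ Metric.ball x₁ r, (x, M) ∈ epi (tailSup g 0)) {n : ℕ}
    (a : TailMinorant g n) :
    ∃ b : TailMinorant g (n + 1), b.ρ ≤ a.ρ ∧
      ∀ x t, (x, t) ∈ epi (g n) → (a.Y - b.Y) x + (a.C - b.C) ≤ (a.ρ - b.ρ) * t := by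
  obtain ⟨l, m, y₁, y₂, c₁, c₂, hl, hm, hlm, hy, hc, h1, h2⟩ :=
    exists_affine_split (hg n) (convex_epi_tailSup hg (n + 1)) epi_upward epi_upward
      (x₁ := x₁) (a := M) (mem_epi_tailSup.1 (hb _ (Metric.mem_ball_self hr)) n (Nat.zero_le _))
      hr (fun x hx => mem_epi_tailSup.2 fun k _ => mem_epi_tailSup.1 (hb x hx) k (Nat.zero_le _))
      a.nonneg a.Y a.C fun x t h1 h2 => a.le x t (mem_epi_tailSup_of h1 h2)
  refine ⟨⟨m, y₂, c₂, hm, h2⟩, ?_, ?_⟩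
  · simp only; linarith
  · intro x t hx
    simp only [← hlm, ← hy, ← hc, add_sub_cancel_right]
    exact h1 x t hx

theorem norm_le_of_le_on_ball {y : StrongDual ℝ E} {r e : ℝ} (hr : 0 < r) (he : 0 ≤ e)
    (h : ∀ v : E, ‖v‖ < r → y v ≤ e) : ‖y‖ ≤ e / (r / 2) := by
  refine ContinuousLinearMap.opNorm_le_of_unit_norm (by positivity) fun v hv => ?_
  have hn : ‖(r / 2) • v‖ < r := by
    rw [norm_smul, hv, Real.norm_of_nonneg (by positivity)]
    linarith
  have h1 := h _ hn
  have h2 := h _ ((norm_neg _).trans_lt hn)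
  rw [map_neg] at h2
  rw [map_smul, smul_eq_mul] at h1 h2
  rw [le_div_iff₀ (by positivity), Real.norm_eq_abs, mul_comm, ← abs_of_pos (half_pos hr),
    ← abs_mul]
  exact abs_le.2 ⟨by linarith, h1⟩

/-- If `Y + C` minorizes `ρ * sup_k g_k` and the biconjugates of the `g_k` and of their upper
limit are nonpositive at `z`, then so is `Y + C`. -/
theorem TailMinorant.eval_le_zero {g : ℕ → E → EReal} (hg : ∀ k, IsConvexFn (g k)) {x₁ : E}
    {r M : ℝ} (hr : 0 < r) (hb : ∀ x ∈ Metric.ball x₁ r, (x, M) ∈ epi (tailSup g 0))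
    {y₀ : StrongDual ℝ E} {c₀ : ℝ} (h₀ : ∀ x t, (x, t) ∈ epi (tailSup g 0) → y₀ x + c₀ ≤ t)
    {z : StrongDual ℝ (StrongDual ℝ E)}
    (hz : z ∈ weakStarClosure (effDom (biconj (tailSup g 0))))
    (hgz : ∀ k, biconj (g k) z ≤ 0)
    (hlim : biconj (fun x => limsup (fun k => g k x) atTop) z ≤ 0)
    (a : TailMinorant g 0) : z a.Y + a.C ≤ 0 := by
  choose! next hρ hnext using
    fun n (b : TailMinorant g n) => TailMinorant.exists_succ hg hr hb b
  let s : ∀ n, TailMinorant g n := fun n => Nat.rec a next n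
  have hs : ∀ n, s (n + 1) = next n (s n) := fun n => rfl
  have hball : ∀ n, ∀ x ∈ Metric.ball x₁ r, (x, M) ∈ epi (tailSup g n) := fun n x hx =>
    mem_epi_tailSup.2 fun k _ => mem_epi_tailSup.1 (hb x hx) k (Nat.zero_le _)
  have hdec : ∀ n x t, (x, t) ∈ epi (g n) →
      ((s n).Y - (s (n + 1)).Y) x + ((s n).C - (s (n + 1)).C) ≤
        ((s n).ρ - (s (n + 1)).ρ) * t := fun n => hnext n (s n)
  have hρanti : Antitone fun n => (s n).ρ := antitone_nat_of_succ_le fun n => hρ n (s n)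
  -- The gap at `x₁` below the bound `ρ * M`. Its decrements bound `Y n - Y (n + 1)` on the ball of
  -- radius `r`, and their sum telescopes to at most `e 0`.
  set e : ℕ → ℝ := fun n => (s n).ρ * M - (s n).Y x₁ - (s n).C with he
  have he0 : ∀ n, 0 ≤ e n := fun n => by
    have := (s n).le x₁ M (hball n x₁ (Metric.mem_ball_self hr))
    simp only [he]; linarith
  have hv : ∀ n (v : E), ‖v‖ < r → ((s n).Y - (s (n + 1)).Y) v ≤ e n - e (n + 1) := by
    intro n v hv
    have := hdec n (x₁ + v) M (mem_epi_tailSup.1 (hball n _ (by simpa using hv)) n le_rfl)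
    simp only [he, sub_apply, map_add] at this ⊢
    linarith
  have hediff : ∀ n, 0 ≤ e n - e (n + 1) := fun n => by simpa using hv n 0 (by simpa using hr)
  have heanti : Antitone e := antitone_nat_of_succ_le fun n => by linarith [hediff n]
  have hYstep : ∀ n, ‖(s n).Y - (s (n + 1)).Y‖ ≤ (e n - e (n + 1)) / (r / 2) := fun n =>
    norm_le_of_le_on_ball hr (hediff n) (hv n)
  have hsum : Summable fun n => (e n - e (n + 1)) / (r / 2) := by
    refine Summable.div_const ?_ (r / 2)
    refine summable_of_sum_range_le hediff (c := e 0) fun n => ?_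
    rw [Finset.sum_range_sub']
    linarith [he0 n]
  obtain ⟨Y, hY⟩ : ∃ Y, Tendsto (fun n => (s n).Y) atTop (𝓝 Y) :=
    cauchySeq_tendsto_of_complete
      (cauchySeq_of_dist_le_of_summable _ (fun n => by rw [dist_eq_norm]; exact hYstep n) hsum)
  obtain ⟨ρ, hρlim⟩ : ∃ ρ, Tendsto (fun n => (s n).ρ) atTop (𝓝 ρ) :=
    ⟨_, tendsto_atTop_ciInf hρanti ⟨0, by rintro _ ⟨n, rfl⟩; exact (s n).nonneg⟩⟩
  obtain ⟨e', he'⟩ : ∃ e', Tendsto e atTop (𝓝 e') :=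
    ⟨_, tendsto_atTop_ciInf heanti ⟨0, by rintro _ ⟨n, rfl⟩; exact he0 n⟩⟩
  have hYx : ∀ x, Tendsto (fun n => (s n).Y x) atTop (𝓝 (Y x)) := fun x =>
    ((ContinuousLinearMap.apply ℝ ℝ x).continuous.tendsto Y).comp hY
  obtain ⟨C, hC⟩ : ∃ C, Tendsto (fun n => (s n).C) atTop (𝓝 C) := by
    refine ⟨ρ * M - Y x₁ - e', ?_⟩
    have := ((hρlim.mul_const M).sub (hYx x₁)).sub he'
    refine this.congr fun n => ?_
    simp only [he]; ring
  have hρ0 : 0 ≤ ρ := ge_of_tendsto' hρlim fun n => (s n).nonneg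
  have hmain : ∀ x t, (x, t) ∈ epi (fun x => limsup (fun k => g k x) atTop) →
      Y x + C ≤ ρ * t := by
    intro x t hx
    -- A limsup at most `t` bounds the tails only by heights `u > t`; then `u` decreases to `t`.
    have hlt : ∀ u : ℝ, t < u → Y x + C ≤ ρ * u := by
      intro u hu
      have hev : ∀ᶠ k in atTop, g k x < (u : EReal) :=
        eventually_lt_of_limsup_lt (lt_of_le_of_lt hx (EReal.coe_lt_coe_iff.2 hu))
      obtain ⟨n₀, hn₀⟩ := eventually_atTop.1 hev
      refine le_of_tendsto_of_tendsto ((hYx x).add hC) (hρlim.mul_const u) ?_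
      filter_upwards [eventually_ge_atTop n₀] with n hn
      exact (s n).le x u (mem_epi_tailSup.2 fun k hk => (hn₀ k (hn.trans hk)).le)
    have hcont : Tendsto (fun u : ℝ => ρ * u) (𝓝[>] t) (𝓝 (ρ * t)) :=
      ((continuous_const.mul continuous_id).tendsto t).mono_left nhdsWithin_le_nhds
    exact ge_of_tendsto hcont (by filter_upwards [self_mem_nhdsWithin] with u hu using hlt u hu)
  have hdomk : ∀ k, effDom (tailSup g 0) ⊆ effDom (g k) := fun k x hx =>
    lt_of_le_of_lt (le_iSup₂ (f := fun k (_ : k ≥ 0) => g k x) k (Nat.zero_le k)) hx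
  have hdomlim : effDom (tailSup g 0) ⊆ effDom fun x => limsup (fun k => g k x) atTop := by
    intro x hx
    refine lt_of_le_of_lt (b := tailSup g 0 x) ?_ hx
    exact limsup_le_of_le (h := Eventually.of_forall fun k =>
      le_iSup₂ (f := fun k (_ : k ≥ 0) => g k x) k (Nat.zero_le k))
  have hmono : ∀ n, z a.Y + a.C ≤ z (s n).Y + (s n).C := by
    intro n
    induction n with
    | zero => exact le_rfl
    | succ n ih =>
      have := le_zero_of_biconj_le_zero h₀ (hdomk n) (sub_nonneg.2 (hρ n (s n))) (hdec n) hz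
        (hgz n)
      rw [map_sub] at this
      linarith
  have hlast := le_zero_of_biconj_le_zero h₀ hdomlim hρ0 hmain hz hlim
  exact (ge_of_tendsto' (((z.continuous.tendsto Y).comp hY).add hC) hmono).trans hlast

end Tail

/-! ### Lagrangian duality -/

section Duality

variable {E : Type*} [NormedAddCommGroup E] [NormedSpace ℝ E]

/-- Split against the vertical line over `x₁`: heights unbounded below and above force its
multiplier to vanish. -/
theorem exists_affine_minorant {f : E → EReal} (hf : IsConvexFn f) {x₁ : E} {r M b : ℝ}
    (hr : 0 < r) (hball : ∀ x ∈ Metric.ball x₁ r, (x, M) ∈ epi f) (hb : (b : EReal) ≤ f x₁) :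
    ∃ (y : StrongDual ℝ E) (c : ℝ), ∀ x t, (x, t) ∈ epi f → y x + c ≤ t := by
  obtain ⟨l, m, y₁, y₂, c₁, c₂, hl, hm, hlm, -, -, h1, h2⟩ :=
    exists_affine_split (P := {x₁} ×ˢ Set.univ) ((convex_singleton x₁).prod convex_univ) hf
      (fun x t t' h _ => ⟨h.1, trivial⟩) epi_upward (x₁ := x₁) (a := 0) ⟨rfl, trivial⟩ hr hball
      zero_le_one 0 b (by
        rintro x t ⟨hx, -⟩ ht
        obtain rfl : x = x₁ := hx
        have := EReal.coe_le_coe_iff.1 (hb.trans ht)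
        simpa using this)
  have hl0 : l = 0 := by
    by_contra hne
    have := h1 x₁ ((y₁ x₁ + c₁ - 1) / l) ⟨rfl, trivial⟩
    rw [mul_div_cancel₀ _ hne] at this
    linarith
  obtain rfl : m = 1 := by linarith
  exact ⟨y₂, c₂, fun x t hx => by simpa using h2 x t hx⟩

/-- Weak duality bound for the relaxation of a program with a sequence of constraints. -/
theorem le_biconj_of_relaxed_feasible {f₀ : E → EReal} {g : ℕ → E → EReal}
    (hf₀ : IsConvexFn f₀) (hg : ∀ k, IsConvexFn (g k)) {α : ℝ}
    (hα : ∀ x, (∀ k, g k x ≤ 0) → (α : EReal) ≤ f₀ x)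
    {x₀ : E} (hx₀ : x₀ ∈ effDom f₀) (hslater : tailSup g 0 x₀ < 0)
    {x₁ : E} (hx₁ : x₁ ∈ effDom f₀) {r M : ℝ} (hr : 0 < r)
    (hball : ∀ x ∈ Metric.ball x₁ r, (x, M) ∈ epi (tailSup g 0)) (hbot : tailSup g 0 x₁ ≠ ⊥)
    {z : StrongDual ℝ (StrongDual ℝ E)}
    (hz : z ∈ weakStarClosure (effDom (biconj (tailSup g 0))))
    (hgz : ∀ k, biconj (g k) z ≤ 0)
    (hlim : biconj (fun x => limsup (fun k => g k x) atTop) z ≤ 0) :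
    (α : EReal) ≤ biconj f₀ z := by
  obtain ⟨b, -, hb⟩ := EReal.lt_iff_exists_real_btwn.1 (bot_lt_iff_ne_bot.2 hbot)
  obtain ⟨y₀, c₀, h₀⟩ := exists_affine_minorant (convex_epi_tailSup hg 0) hr hball hb.le
  obtain ⟨a₁, ha₁⟩ := exists_mem_epi hx₁
  have hPconv : Convex ℝ ((fun p : E × ℝ => (0, α) + p) ⁻¹' epi f₀) :=
    hf₀.translate_preimage_right _
  have hmemP : ∀ x t, (x, t) ∈ (fun p : E × ℝ => (0, α) + p) ⁻¹' epi f₀ ↔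
      (x, α + t) ∈ epi f₀ := fun x t => by simp
  obtain ⟨l, m, y₁, y₂, c₁, c₂, hl, hm, hlm, hy, hc, h1, h2⟩ :=
    exists_affine_split hPconv (convex_epi_tailSup hg 0)
      (fun x t t' h htt' => by
        rw [hmemP] at h ⊢
        exact epi_upward _ _ _ h (by linarith))
      epi_upward (x₁ := x₁) (a := a₁ - α) (by rw [hmemP]; simpa using ha₁) hr hball
      zero_le_one 0 0 (by
        intro x t h1 h2
        rw [hmemP] at h1
        by_contra! ht
        have ht0 : t < 0 := by simpa using ht
        rw [mem_epi_tailSup] at h2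
        have := hα x fun k => (show g k x ≤ t from h2 k (Nat.zero_le k)).trans
          (EReal.coe_le_coe_iff.2 ht0.le)
        have := EReal.coe_le_coe_iff.1 (this.trans h1)
        simp only at this
        linarith)
  have hyx : ∀ x, y₁ x + y₂ x = 0 := fun x => by rw [← add_apply, hy, zero_apply]
  -- If `l = 0`, then `m = 1`, and at the Slater point the two minorants, whose sum is zero, would
  -- add up to something negative.
  have hlpos : 0 < l := by
    refine hl.lt_of_ne fun h => ?_
    subst h
    obtain ⟨s, hs, hs0⟩ := EReal.lt_iff_exists_real_btwn.1 hslater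
    obtain ⟨a₀, ha₀⟩ := exists_mem_epi hx₀
    have e1 := h1 x₀ (a₀ - α) (by rw [hmemP]; simpa using ha₀)
    have e2 := h2 x₀ s hs.le
    have e3 := hyx x₀
    have hs0' : s < 0 := EReal.coe_lt_coe_iff.1 hs0
    obtain rfl : m = 1 := by linarith
    linarith
  have hrest := TailMinorant.eval_le_zero hg hr hball h₀ hz hgz hlim ⟨m, y₂, c₂, hm, h2⟩
  simp only at hrest
  have hzy : z y₁ + z y₂ = 0 := by rw [← map_add, hy, map_zero]
  have hbound := affine_div_le_biconj (g := f₀) (y := y₁) (c := c₁ + l * α) hlpos (by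
    intro x t hx
    have := h1 x (t - α) (by rw [hmemP]; simpa using hx)
    linarith) z
  refine le_trans (EReal.coe_le_coe_iff.2 ?_) hbound
  rw [le_div_iff₀ hlpos]
  linarith

end Duality

/-! ### Reduction to a sequence of constraints -/

section Program

variable {X : Type*} [NormedAddCommGroup X] [NormedSpace ℝ X]

theorem relaxedValue_le_value (N : ℕ∞) (f : ℕ → X → EReal) : relaxedValue N f ≤ value N f := by
  refine le_iInf₂ fun x hx => ?_
  refine (iInf₂_le (NormedSpace.inclusionInDoubleDual ℝ X x) ⟨?_, ?_, ?_⟩).trans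
    (biconj_le_self (f 0) x)
  · exact fun k hk => (biconj_le_self _ x).trans (hx k hk)
  · refine (biconj_le_self _ x).trans ?_
    rw [limsupFn]
    split_ifs with hN
    · refine limsup_le_of_le (h := ?_)
      -- Index `0` is the objective, so it must be excluded.
      filter_upwards [eventually_ge_atTop 1] with k hk
      exact hx k ⟨hk, by simp [hN]⟩
    · exact bot_le
  · refine subset_closure (X := WeakDual ℝ (StrongDual ℝ X)) ⟨_, ?_, rfl⟩
    refine lt_of_le_of_lt ((biconj_le_self _ x).trans (iSup₂_le hx)) ?_
    exact EReal.zero_lt_top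

/-- The constraints as an infinite sequence, the last one being repeated if there are finitely
many. -/
noncomputable def constraintSeq {S : Type*} (N : ℕ∞) (f : ℕ → S → EReal) (k : ℕ) : S → EReal :=
  f (min ((k + 1 : ℕ) : ℕ∞) N).toNat

theorem coe_toNat_min (N : ℕ∞) (k : ℕ) :
    (((min (k : ℕ∞) N).toNat : ℕ) : ℕ∞) = min (k : ℕ∞) N :=
  ENat.natCast_toNat (ne_top_of_le_ne_top (ENat.natCast_ne_top k) (min_le_left _ _))

theorem toNat_min_mem_constraintIdx {N : ℕ∞} (hN : N ≠ 0) (k : ℕ) :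
    (min ((k + 1 : ℕ) : ℕ∞) N).toNat ∈ constraintIdx N := by
  refine ⟨?_, ?_⟩
  · rw [← Nat.cast_le (α := ℕ∞), coe_toNat_min]
    refine le_min (by exact_mod_cast Nat.succ_le_succ (Nat.zero_le k)) ?_
    exact_mod_cast Order.one_le_iff_pos.2 (pos_iff_ne_zero.2 hN)
  · rw [coe_toNat_min]
    exact min_le_right _ _

theorem constraintSeq_of_mem {S : Type*} {N : ℕ∞} (f : ℕ → S → EReal) {k : ℕ} (hk : k ∈ constraintIdx N) :
    constraintSeq N f (k - 1) = f k := by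
  rw [constraintSeq, Nat.sub_add_cancel hk.1, min_eq_left hk.2, ENat.toNat_natCast]

theorem tailSup_constraintSeq {S : Type*} {N : ℕ∞} (hN : N ≠ 0) (f : ℕ → S → EReal) :
    tailSup (constraintSeq N f) 0 = supFn N f := by
  funext x
  refine le_antisymm (iSup₂_le fun k _ => ?_) (iSup₂_le fun k hk => ?_)
  · exact le_iSup₂ (f := fun k (_ : k ∈ constraintIdx N) => f k x) _
      (toNat_min_mem_constraintIdx hN k)
  · rw [← constraintSeq_of_mem f hk]
    exact le_iSup₂ (f := fun k (_ : k ≥ 0) => constraintSeq N f k x) (k - 1) (Nat.zero_le _)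

theorem biconj_limsup_constraintSeq_le_zero {N : ℕ∞} (hN : N ≠ 0) {f : ℕ → X → EReal}
    {z : StrongDual ℝ (StrongDual ℝ X)} (hz : z ∈ relaxedFeasible N f) :
    biconj (fun x => limsup (fun k => constraintSeq N f k x) atTop) z ≤ 0 := by
  by_cases hT : N = ⊤
  · have h : (fun x => limsup (fun k => constraintSeq N f k x) atTop) = limsupFn N f := by
      funext x
      rw [limsupFn, if_pos hT, ← limsup_nat_add (fun k => f k x) 1]
      simp [constraintSeq, hT, -Nat.cast_add]
    rw [h]
    exact hz.2.1
  -- The repeated sequence is eventually the last constraint, so its upper limit is already covered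
  -- by the ordinary constraints.
  · have h : (fun x => limsup (fun k => constraintSeq N f k x) atTop) = f N.toNat := by
      funext x
      have hev : (fun k => constraintSeq N f k x) =ᶠ[atTop] fun _ => f N.toNat x := by
        filter_upwards [eventually_ge_atTop N.toNat] with k hk
        rw [constraintSeq, min_eq_right]
        rw [← ENat.natCast_toNat hT, Nat.cast_le]
        lia
      rw [limsup_congr hev, limsup_const]
    rw [h]
    refine hz.1 _ ⟨?_, (ENat.natCast_toNat hT).le⟩
    rw [Nat.one_le_iff_ne_zero, Ne, ENat.toNat_eq_zero]
    tauto

end Program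

end CvxRelax

theorem theorem3p9 {X : Type*} [NormedAddCommGroup X] [NormedSpace ℝ X] [CompleteSpace X]
    (N : ℕ∞) (f : ℕ → X → EReal)
    (hproper₀ : CvxRelax.IsProper (f 0)) (hconvex₀ : CvxRelax.IsConvexFn (f 0))
    (hproper : ∀ k ∈ CvxRelax.constraintIdx N, CvxRelax.IsProper (f k))
    (hconvex : ∀ k ∈ CvxRelax.constraintIdx N, CvxRelax.IsConvexFn (f k))
    (hslater : CvxRelax.Slater N f)
    (hcont : ∃ x ∈ CvxRelax.effDom (f 0),
      x ∈ CvxRelax.effDom (CvxRelax.supFn N f) ∧ ContinuousAt (CvxRelax.supFn N f) x) :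
    CvxRelax.relaxedValue N f = CvxRelax.value N f := by
  open CvxRelax in
  refine le_antisymm (relaxedValue_le_value N f) (le_iInf₂ fun z hz => ?_)
  -- With no constraint to repeat, `constraintSeq` would return the objective `f 0`.
  by_cases hN : N = 0
  · refine le_trans (le_of_eq ?_) (iInf_le_biconj (f 0) z)
    refine iInf_congr fun x => iInf_pos fun k hk => ?_
    have h0 : k = 0 := by simpa [hN] using hk.2
    exact absurd hk.1 (by simp [h0])
  refine EReal.ge_of_forall_gt_iff_ge.1 fun α hα => ?_
  obtain ⟨x₀, hx₀, hs⟩ := hslater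
  obtain ⟨x₁, hx₁, hdom, hc⟩ := hcont
  obtain ⟨M, hM, -⟩ := EReal.lt_iff_exists_real_btwn.1 hdom
  obtain ⟨r, hr, hball⟩ := Metric.eventually_nhds_iff_ball.1 (hc.eventually_lt_const hM)
  have hsup := tailSup_constraintSeq hN f
  have hidx := toNat_min_mem_constraintIdx hN
  refine le_biconj_of_relaxed_feasible (g := constraintSeq N f) hconvex₀
    (fun k => hconvex _ (hidx k)) ?_ hx₀ (by rwa [hsup]) hx₁ (M := M) hr ?_ ?_
    (by rw [hsup]; exact hz.2.2) (fun k => hz.1 _ (hidx k))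
    (biconj_limsup_constraintSeq_le_zero hN hz)
  · intro x hx
    refine hα.le.trans (iInf₂_le x fun k hk => ?_)
    rw [← constraintSeq_of_mem f hk]
    exact hx _
  · rw [hsup]
    exact fun x hx => (hball x hx).le
  · have h0 : constraintSeq N f 0 x₁ ≤ tailSup (constraintSeq N f) 0 x₁ :=
      le_iSup₂ (f := fun k (_ : k ≥ 0) => constraintSeq N f k x₁) 0 le_rfl
    exact ne_bot_of_le_ne_bot ((hproper _ (hidx 0)).2 x₁) h0
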